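/- All topological spaces are assumed to be Hausdorff. A map $\pi : X \to Y$ between topological spaces is called perfect if it is continuous, closed and onto, and all its fibers $\pi^{-1}(y)$, $y\in Y$, are compact. A topological group $G$ is called $Pm$-factorizable if for every continuous map $f : G \to M$ to a metrizable space $M$ there exist a second-countable topological group $H$, a perfect homomorphism $\pi : G \to H$ (onto $H$), and a continuous map $g : H \to M$ such that $f = g \circ \pi$. Theorem. Let $G$ be a $Pm$-factorizable topological group and let $K$ be an arbitrary compact topological group. Then the product group $G \times K$, with the product topology, is $Pm$-factorizable. -/

import Mathlib

universe u v

/-- A perfect map: continuous, closed, onto, with compact fibers. -/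
structure IsPerfectMap {X : Type u} {Y : Type v} [TopologicalSpace X] [TopologicalSpace Y]
    (f : X → Y) : Prop where
  continuous : Continuous f
  isClosedMap : IsClosedMap f
  surjective : Function.Surjective f
  isCompact_fiber : ∀ y : Y, IsCompact (f ⁻¹' {y})

/-- A topological group `G` is `Pm`-factorizable if every continuous map `f` from `G` to a metrizable
space `M` factors as `f = g ∘ π`, where `π` is a perfect homomorphism of `G` onto a second-countable
(Hausdorff) topological group `H` and `g : H → M` is continuous.

Taking `M` and `H` in the universe of `G` is no restriction: `H` and the range of `f`
are both images of `G`. -/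
def PmFactorizable (G : Type u) [Group G] [TopologicalSpace G] : Prop :=
  ∀ (M : Type u) [TopologicalSpace M] [TopologicalSpace.MetrizableSpace M] (f : G → M),
    Continuous f →
      ∃ (H : Type u) (_ : Group H) (_ : TopologicalSpace H) (π : G →* H) (g : H → M),
        IsTopologicalGroup H ∧ T2Space H ∧ SecondCountableTopology H ∧
          IsPerfectMap π ∧ Continuous g ∧ f = g ∘ π

/-! Curry `f` to a map from `G` to `C(K, M)`, metrizable since `K` is compact, and factor it through
a perfect `π : G → H`. Insertion-invisible elements form a closed normal subgroup `N` of `K`;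
separability of `H` makes `K ⧸ N` second countable. Then `f` descends to `H × (K ⧸ N)`. -/

/-- `PmFactorizable` allows targets in any universe: only the range of the map matters. -/
lemma PmFactorizable.exists_factorization {G : Type u} [Group G] [TopologicalSpace G]
    (hG : PmFactorizable G) {M : Type v} [TopologicalSpace M]
    [TopologicalSpace.MetrizableSpace M] (f : G → M) (hf : Continuous f) :
    ∃ (H : Type u) (_ : Group H) (_ : TopologicalSpace H) (π : G →* H) (g : H → M),
      IsTopologicalGroup H ∧ T2Space H ∧ SecondCountableTopology H ∧
        IsPerfectMap π ∧ Continuous g ∧ f = g ∘ π := by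
  let e : Set.range f ≃ Shrink.{u} (Set.range f) := equivShrink _
  let : TopologicalSpace (Shrink.{u} (Set.range f)) := .induced e.symm inferInstance
  have hemb : Topology.IsEmbedding e.symm := ⟨⟨rfl⟩, e.symm.injective⟩
  have : TopologicalSpace.MetrizableSpace (Shrink.{u} (Set.range f)) := hemb.metrizableSpace
  have hcont : Continuous fun x => e ⟨f x, x, rfl⟩ := by
    rw [hemb.continuous_iff]
    simpa [Function.comp_def] using hf.subtype_mk fun x => ⟨x, rfl⟩
  obtain ⟨H, _, _, π, g, h₁, h₂, h₃, hπ, hg, hfg⟩ := hG _ _ hcont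
  refine ⟨H, _, _, π, fun y => (e.symm (g y)).1, h₁, h₂, h₃, hπ,
    continuous_subtype_val.comp (hemb.continuous.comp hg), ?_⟩
  funext x
  have hx : e ⟨f x, x, rfl⟩ = g (π x) := congrFun hfg x
  simp [← hx]

lemma IsPerfectMap.isProperMap {X : Type u} {Y : Type v} [TopologicalSpace X]
    [TopologicalSpace Y] {f : X → Y} (hf : IsPerfectMap f) : IsProperMap f :=
  isProperMap_iff_isClosedMap_and_compact_fibers.2
    ⟨hf.continuous, hf.isClosedMap, hf.isCompact_fiber⟩

lemma IsProperMap.isPerfectMap {X : Type u} {Y : Type v} [TopologicalSpace X]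
    [TopologicalSpace Y] {f : X → Y} (hf : IsProperMap f) (hs : Function.Surjective f) :
    IsPerfectMap f :=
  have h := isProperMap_iff_isClosedMap_and_compact_fibers.1 hf
  ⟨h.1, h.2.1, hs, h.2.2⟩

/-- The elements whose insertion into a product is not seen by any of the functions `F i`. -/
def insertionKernel {ι K M : Type*} [Group K] (F : ι → K → M) : Subgroup K where
  carrier := {a | ∀ i x y, F i (x * a * y) = F i (x * y)}
  one_mem' := by simp
  mul_mem' {a b} ha hb i x y := by
    rw [← mul_assoc, hb, ha]
  inv_mem' {a} ha i x y := by
    simpa using (ha i (x * a⁻¹) y).symm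

lemma mem_insertionKernel {ι K M : Type*} [Group K] {F : ι → K → M} {a : K} :
    a ∈ insertionKernel F ↔ ∀ i x y, F i (x * a * y) = F i (x * y) := Iff.rfl

instance insertionKernel_normal {ι K M : Type*} [Group K] (F : ι → K → M) :
    (insertionKernel F).Normal where
  conj_mem a ha b i x y := by
    simpa [mul_assoc] using ha i (x * b) (b⁻¹ * y)

lemma eq_of_inv_mul_mem_insertionKernel {ι K M : Type*} [Group K] {F : ι → K → M} {a b : K}
    (h : a⁻¹ * b ∈ insertionKernel F) (i : ι) : F i a = F i b := by
  simpa using (h i a 1).symm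

lemma isClosed_insertionKernel {ι K M : Type*} [Group K] [TopologicalSpace K]
    [IsTopologicalGroup K] [TopologicalSpace M] [T2Space M] {F : ι → K → M}
    (hF : ∀ i, Continuous (F i)) : IsClosed (insertionKernel F : Set K) := by
  have : (insertionKernel F : Set K) = ⋂ i, ⋂ x, ⋂ y, {a | F i (x * a * y) = F i (x * y)} := by
    ext a
    simp [mem_insertionKernel]
  rw [this]
  refine isClosed_iInter fun i => isClosed_iInter fun x => isClosed_iInter fun y => ?_
  exact isClosed_eq ((hF i).comp (by fun_prop)) continuous_const

/-- For a separable family of continuous functions on a compact group with values in a metrizable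
space, the quotient by the insertion kernel is second countable. -/
lemma secondCountableTopology_quotient_insertionKernel {H K M : Type*} [TopologicalSpace H]
    [TopologicalSpace.SeparableSpace H] [Nonempty H] [Group K] [TopologicalSpace K]
    [IsTopologicalGroup K] [CompactSpace K] [TopologicalSpace M]
    [TopologicalSpace.MetrizableSpace M] {F : H → K → M}
    (hF : Continuous fun p : H × K => F p.1 p.2) :
    SecondCountableTopology (K ⧸ insertionKernel F) := by
  let := TopologicalSpace.metrizableSpaceMetric M
  let d := TopologicalSpace.denseSeq H
  -- Two-sided translates make the fibers of `Φ` exactly the cosets of the kernel; countably many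
  -- indices keep the target metrizable.
  let Φ : K → ℕ → C(K × K, M) := fun a n =>
    ⟨fun p => F (d n) (p.1 * a * p.2),
      hF.comp (continuous_const.prodMk (by fun_prop))⟩
  have hΦ : Continuous Φ := continuous_pi fun n =>
    ContinuousMap.continuous_of_continuous_uncurry _ <|
      hF.comp (continuous_const.prodMk (by fun_prop :
        Continuous fun q : K × (K × K) => q.2.1 * q.1 * q.2.2))
  have hker : ∀ a b, Φ a = Φ b ↔ a⁻¹ * b ∈ insertionKernel F := by
    refine fun a b => ⟨fun h i x y => ?_, fun h => ?_⟩
    · have heq : (fun i => F i (x * (a⁻¹ * b) * y)) = fun i => F i (x * y) := by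
        refine Continuous.ext_on (TopologicalSpace.denseRange_denseSeq H)
          (hF.comp (continuous_id.prodMk continuous_const))
          (hF.comp (continuous_id.prodMk continuous_const)) ?_
        rintro _ ⟨n, rfl⟩
        have := DFunLike.congr_fun (congrFun h n) (x * a⁻¹, y)
        simpa [Φ, d, mul_assoc] using this.symm
      exact congrFun heq i
    · funext n
      ext p
      have := h (d n) (p.1 * a) p.2
      simpa [Φ, mul_assoc] using this.symm
  let Ψ : K ⧸ insertionKernel F → ℕ → C(K × K, M) :=
    Quotient.lift Φ fun a b h => (hker a b).2 (QuotientGroup.leftRel_apply.1 h)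
  have hΨ : Continuous Ψ := hΦ.quotient_lift _
  have hinj : Function.Injective Ψ := by
    rintro ⟨a⟩ ⟨b⟩ h
    exact QuotientGroup.eq.2 ((hker a b).1 h)
  -- A continuous injection from a compact space to a Hausdorff one is an embedding, and compact
  -- metrizable spaces are second countable.
  have hemb := (hΨ.isClosedEmbedding hinj).isEmbedding
  have := hemb.metrizableSpace
  let := TopologicalSpace.metrizableSpaceMetric (K ⧸ insertionKernel F)
  infer_instance

theorem theorem5p10
    (G : Type u) [Group G] [TopologicalSpace G] [IsTopologicalGroup G] [T2Space G]
    (K : Type v) [Group K] [TopologicalSpace K] [IsTopologicalGroup K] [T2Space K]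
    [CompactSpace K] (hG : PmFactorizable G) :
    PmFactorizable (G × K) := by
  intro M _ _ f hf
  let := TopologicalSpace.metrizableSpaceMetric M
  obtain ⟨H, _, _, π, g, _, _, _, hπ, hg, hfg⟩ :=
    hG.exists_factorization (fun x => (⟨fun k => f (x, k), by fun_prop⟩ : C(K, M)))
      (ContinuousMap.continuous_of_continuous_uncurry _ hf)
  let F : H → K → M := fun h k => g h k
  have hF : Continuous fun p : H × K => F p.1 p.2 :=
    ContinuousMap.continuous_uncurry_of_continuous ⟨g, hg⟩
  let N := insertionKernel F
  have hN : IsClosed (N : Set K) :=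
    isClosed_insertionKernel fun h => hF.comp (continuous_const.prodMk continuous_id)
  have : SecondCountableTopology (K ⧸ N) := secondCountableTopology_quotient_insertionKernel hF
  have hmk : Continuous (QuotientGroup.mk' N) := continuous_quot_mk
  let F' : H × (K ⧸ N) → M := fun p => Quotient.liftOn' p.2 (F p.1) fun a b hab =>
    eq_of_inv_mul_mem_insertionKernel (QuotientGroup.leftRel_apply.1 hab) p.1
  -- Openness matters: a product of mere quotient maps need not be a quotient map.
  have hq : IsOpenQuotientMap (Prod.map id (QuotientGroup.mk' N) : H × K → H × (K ⧸ N)) :=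
    IsOpenQuotientMap.id.prodMap QuotientGroup.isOpenQuotientMap_mk
  refine ⟨H × (K ⧸ N), inferInstance, inferInstance, π.prodMap (QuotientGroup.mk' N), F',
    inferInstance, inferInstance, inferInstance, ?_, hq.isQuotientMap.continuous_iff.2 hF, ?_⟩
  -- Properness, unlike closedness, passes to products; the quotient map is proper as `K` is compact
  -- and `K ⧸ N` Hausdorff.
  · exact (hπ.isProperMap.prodMap hmk.isProperMap).isPerfectMap
      (hπ.surjective.prodMap (QuotientGroup.mk'_surjective N))
  · funext p
    exact DFunLike.congr_fun (congrFun hfg p.1) p.2
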